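/- Conventions. A Grothendieck category is a cocomplete Abelian category that has a generator and in which directed colimits are exact. An object $N$ of it is Noetherian if its lattice of subobjects satisfies the ascending chain condition. A ring $R$ is stably finite if, for every integer $k\ge 1$ and all $A,B\in\mathrm{Mat}_k(R)$, $AB=1$ implies $BA=1$. For a set $B$, a $B$-labeled digraph is a pair $\Gamma=(V,E)$ with $E\subseteq V\times V$, together with a map $E\to B$. For $v\in V$ and $r\in\mathbb N$, $N_r(v)$ is the labeled digraph induced on the set of vertices that can be reached from $v$ by a directed path with at most $r$ edges. An isomorphism of $B$-labeled digraphs is a bijection between the vertex sets that preserves and reflects edges and preserves labels. If $B$ is a finite symmetric set of generators of a group $G$, the Cayley graph $\Gamma(G,B)$ has vertex set $G$ and edges $(g,gb)$, $g\in G$, $b\in B$, with $(g,gb)$ labeled by $b$; $N_r(B)$ denotes the $r$-neighborhood of $1$ in $\Gamma(G,B)$. A finitely generated group $G$ is sofic if for every finite symmetric set of generators $B$ of $G$, every $\varepsilon\in(0,1)$ and every $r\in\mathbb N$ there are a finite $B$-labeled digraph $\Gamma=(V,E)$ with $V\neq\emptyset$ and a subset $V_0\subseteq V$ such that $|V_0|\ge(1-\varepsilon)|V|$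 and $N_r(v)\cong N_r(B)$ as $B$-labeled digraphs for every $v\in V_0$. An arbitrary group is sofic if each of its finitely generated subgroups is sofic. For a group $G$, let $\mathcal G^G=\mathrm{Fun}(G,\mathcal G)$ be the category of representations of $G$ on $\mathcal G$ (functors to $\mathcal G$ from $G$ viewed as a category with one object), and let $\uparrow_{\mathbf 1}^G\colon\mathcal G\to\mathcal G^G$ be the left adjoint of the forgetful functor $\mathcal G^G\to\mathcal G$. Explicitly, $\uparrow_{\mathbf 1}^G X$ is the coproduct $X^{(G)}$ of copies of $X$ indexed by $G$, with the Bernoulli shift: $g\in G$ maps the copy of $X$ with index $h$ identically onto the copy with index $gh$. Theorem. Let $\mathcal G$ be a Grothendieck category, $G$ a sofic group and $N$ a Noetherian object of $\mathcal G$. Then the endomorphism ring $\mathrm{End}_{\mathcal G^G}(\uparrow_{\mathbf 1}^G N)$ is stably finite. -/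

import Mathlib

open CategoryTheory CategoryTheory.Limits

universe v u

/-- A `B`-labeled directed graph on the vertex set `V`: a set of ordered pairs of vertices
(loops are allowed), each of which carries one label in `B`. -/
structure LabeledDigraph (V B : Type*) extends Digraph V where
  /-- The label of an edge. -/
  label : ∀ x y : V, Adj x y → B

namespace LabeledDigraph

/-- There is a directed path with exactly `n` edges (repetitions allowed) from one vertex to
another. -/
def HasPath {V B : Type*} (Γ : LabeledDigraph V B) : ℕ → V → V → Prop
  | 0, x, y => x = y
  | n + 1, x, y => ∃ z, Γ.HasPath n x z ∧ Γ.Adj z y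

/-- The `n`-th neighborhood of `x`: the vertices at directed distance at most `n` from `x`. -/
def neighborhood {V B : Type*} (Γ : LabeledDigraph V B) (n : ℕ) (x : V) : Set V :=
  {y | ∃ m ≤ n, Γ.HasPath m x y}

/-- The labeled digraph induced on a set of vertices. -/
def induce {V B : Type*} (Γ : LabeledDigraph V B) (s : Set V) : LabeledDigraph s B where
  Adj x y := Γ.Adj x y
  label x y h := Γ.label x y h

/-- Isomorphisms of `B`-labeled digraphs: bijections on vertices that preserve and reflect edges
and preserve labels. -/
structure Iso {V W B : Type*} (Γ : LabeledDigraph V B) (Δ : LabeledDigraph W B) extends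
    V ≃ W where
  adj_iff : ∀ x y, Γ.Adj x y ↔ Δ.Adj (toFun x) (toFun y)
  label_eq : ∀ x y (h : Γ.Adj x y), Δ.label (toFun x) (toFun y) ((adj_iff x y).1 h) = Γ.label x y h

/-- The Cayley graph of `G` with respect to `B`: the edges are the pairs `(g, g * b)` with `b ∈ B`,
and the edge `(g, g * b)` has the label `b`. -/
def cayley (G : Type*) [Group G] (B : Finset G) : LabeledDigraph G B where
  Adj g h := g⁻¹ * h ∈ B
  label g h hgh := ⟨g⁻¹ * h, hgh⟩

end LabeledDigraph

/-- The approximation property that defines soficity of a finitely generated group, for every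
finite symmetric generating set `B`, every `ε ∈ (0, 1)` and every radius `r`. -/
def IsSoficFG (G : Type*) [Group G] : Prop :=
  ∀ B : Finset G, (∀ b ∈ B, b⁻¹ ∈ B) → Subgroup.closure (B : Set G) = ⊤ →
    ∀ ε : ℝ, 0 < ε → ε < 1 → ∀ r : ℕ,
      ∃ (V : Type) (_ : Fintype V) (_ : Nonempty V) (Γ : LabeledDigraph V B) (V₀ : Finset V),
        (1 - ε) * (Fintype.card V : ℝ) ≤ (V₀.card : ℝ) ∧
        ∀ x ∈ V₀, Nonempty (LabeledDigraph.Iso (Γ.induce (Γ.neighborhood r x))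
          ((LabeledDigraph.cayley G B).induce ((LabeledDigraph.cayley G B).neighborhood r 1)))

/-- A group is sofic if each of its finitely generated subgroups is sofic. -/
def IsSofic (G : Type*) [Group G] : Prop :=
  ∀ H : Subgroup G, H.FG → IsSoficFG H

namespace GroupRep

variable (G : Type v) [Group G] (C : Type u) [Category.{v} C]

/-- The category of representations of `G` on `C`: functors to `C` from `G`, viewed as a category
with one object. -/
abbrev Rep : Type (max u v) := SingleObj G ⥤ C

/-- The forgetful functor from representations of `G` on `C` to `C`. -/
abbrev restriction : Rep G C ⥤ C := (evaluation (SingleObj G) C).obj (SingleObj.star G)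

/-- The functor that sends `X` to the induced representation, the coproduct of copies of `X`
indexed by `G` with the Bernoulli shift; see `inducedAdjunction` and `ι_comp_induced_map`. -/
noncomputable def induced [HasColimitsOfSize.{v, v} C] : C ⥤ Rep G C :=
  evaluationLeftAdjoint C (SingleObj.star G)

/-- `induced` is left adjoint to `restriction`. -/
noncomputable def inducedAdjunction [HasColimitsOfSize.{v, v} C] :
    induced G C ⊣ restriction G C :=
  evaluationAdjunctionRight C (SingleObj.star G)

variable {G C}

theorem induced_obj_obj [HasColimitsOfSize.{v, v} C] (X : C) :
    ((induced G C).obj X).obj (SingleObj.star G) = ∐ (fun _ : G => X) := rfl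

/-- The inclusion of the copy of `X` with index `g` in the induced representation. -/
noncomputable def ι [HasColimitsOfSize.{v, v} C] (X : C) (g : G) :
    X ⟶ ((induced G C).obj X).obj (SingleObj.star G) :=
  Sigma.ι (fun _ : G => X) g

/-- The element `g` acts on the induced representation by the Bernoulli shift: it maps the copy
of `X` with index `h` identically onto the copy with index `g * h`. -/
theorem ι_comp_induced_map [HasColimitsOfSize.{v, v} C] (X : C) (g h : G) :
    ι X h ≫ ((induced G C).obj X).map (X := SingleObj.star G) (Y := SingleObj.star G) g =
      ι X (g * h) :=
  Sigma.ι_desc (f := fun _ : G => X) _ h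

end GroupRep

/-!
A square matrix over the endomorphism ring of the induced representation of `N` is an endomorphism
of the representation induced from a finite sum of copies of `N`, which is again Noetherian. So it
suffices to show that `End (induced M)` is directly finite for each Noetherian `M`. Exactness of
directed colimits and the ascending chain condition show that a morphism from `M` to a coproduct
is a finite sum of morphisms to its terms; hence `End (induced M)` is the group ring of `G` over
`End M` (`monoidAlgebraToEnd`).

Let `α * β = 1` in this group ring, and suppose that the idempotent `e = 1 - β * α` is not zero.
A Noetherian object has no numerical rank in general, but a suitable length is available modulo a
Serre class: for the sum `E` of the images of the coefficients of `e`, let `T` be a Serre class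
that is maximal among those not containing `E`. The length modulo `T`, the number of factors
outside of `T` in a chain of subobjects, is additive on short exact sequences, and maximality of `T`
forces `E` to have finite length (`exists_serreClass_lengthMod_ne_top`). The largest subobject `M'`
of `M` of finite length is stable under all endomorphisms and contains `E`, so that `α`, `β`
and `e` restrict to `M'`. Since `e * e = e`, each coefficient of `e` is a sum of morphisms that
factor through coefficients of the restriction of `e`, and so one of the latter has an image of
positive length.

This contradicts soficity (`length_image_coeff_eq_zero`). A finite approximation of `G` on a set `V`
turns elements of the group ring into endomorphisms of the sum of copies of `M'` indexed by `V`, and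
this is compatible with products at the points of a subset `V₀` that contains nearly all of `V`.
By `α * β = 1`, the operator of `α` is onto after the projection to the copies of `M'` with index
in `V₀`, and the operator of `e` takes its values in the kernel of this epimorphism, whose length
is at most `(|V| - |V₀|)` times that of `M'`. But the length of its image is at least a fixed
proportion of `|V₀|`, because on well separated points of `V₀` it contains a diagonal matrix with a
given coefficient of `e` on the diagonal (`card_mul_length_image_add_le`).
-/

/-! ### Length modulo a Serre class -/

namespace CategoryTheory

section Length

open ZeroObject

variable {C : Type u} [Category.{v} C] [Abelian C]

/-- `LengthGE T n X` says that the length of `X` modulo `T` is at least `n`: there is a chain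
`X₀ ⊆ X₁ ⊆ ⋯ ⊆ Xₙ = X` of subobjects such that no quotient `Xᵢ₊₁ / Xᵢ` belongs to `T`. -/
def LengthGE (T : ObjectProperty C) : ℕ → ObjectProperty C
  | 0, _ => True
  | n + 1, X => ∃ (A : C) (j : A ⟶ X), Mono j ∧ LengthGE T n A ∧ ¬ T (cokernel j)

variable (T : ObjectProperty C)

theorem ShortComplex.ShortExact.of_exists_lift {A X Q : C} (i : A ⟶ X) (p : X ⟶ Q) (w : i ≫ p = 0)
    [Mono i] [Epi p] (h : ∀ (B : C) (x : B ⟶ X), x ≫ p = 0 → ∃ a, x = a ≫ i) :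
    (ShortComplex.mk i p w).ShortExact :=
  ShortComplex.ShortExact.mk' ((ShortComplex.exact_iff_exact_up_to_refinements _).2 fun B x hx ↦
    let ⟨a, ha⟩ := h B x hx
    ⟨B, 𝟙 B, inferInstance, a, (Category.id_comp x).trans ha⟩) inferInstance inferInstance

/-- Restricting a subobject `X'` of `X₂` along the short exact sequence `0 → X₁ → X₂ → X₃ → 0`:
with `A = X₁ ∩ X'` and `Q` the image of `X'` in `X₃`, the sequence `0 → A → X' → Q → 0` is exact,
and so is `X₁ / A → X₂ / X' → X₃ / Q`. -/
theorem ShortComplex.ShortExact.exists_restrict {S : ShortComplex C} (hS : S.ShortExact) {X' : C}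
    (j : X' ⟶ S.X₂) [Mono j] :
    ∃ (A Q : C) (a : A ⟶ S.X₁) (q : Q ⟶ S.X₃) (i : A ⟶ X') (p : X' ⟶ Q) (w : i ≫ p = 0),
      Mono a ∧ Mono q ∧ a ≫ S.f = i ≫ j ∧ p ≫ q = j ≫ S.g ∧ (ShortComplex.mk i p w).ShortExact ∧
      ∀ [T.IsSerreClass], T (cokernel a) → T (cokernel q) → T (cokernel j) := by
  have := hS.mono_f
  have := hS.epi_g
  have hw : pullback.snd S.f j ≫ factorThruImage (j ≫ S.g) = 0 := by
    rw [← cancel_mono (image.ι (j ≫ S.g)), Category.assoc, image.fac, ← pullback.condition_assoc,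
      S.zero, comp_zero, zero_comp]
  refine ⟨pullback S.f j, image (j ≫ S.g), pullback.fst _ _, image.ι _, pullback.snd _ _,
    factorThruImage _, hw, inferInstance, inferInstance, pullback.condition, image.fac _, ?_, ?_⟩
  · refine .of_exists_lift _ _ _ fun B x hx ↦ ?_
    have hx' : (x ≫ j) ≫ S.g = 0 := by
      rw [Category.assoc, ← image.fac (j ≫ S.g), reassoc_of% hx, zero_comp]
    exact ⟨pullback.lift (hS.exact.lift _ hx') x (hS.exact.lift_f _ _),
      (pullback.lift_snd _ _ _).symm⟩
  · intro _ h₁ h₃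
    let φ : cokernel (pullback.fst S.f j) ⟶ cokernel j :=
      cokernel.map _ _ (pullback.snd _ _) S.f pullback.condition
    let ψ : cokernel j ⟶ cokernel (image.ι (j ≫ S.g)) :=
      cokernel.map _ _ (factorThruImage _) S.g (image.fac _).symm
    have hφψ : φ ≫ ψ = 0 := by
      simp [← cancel_epi (cokernel.π _), φ, ψ]
    refine T.prop_X₂_of_exact (S := ShortComplex.mk φ ψ hφψ) ?_ h₁ h₃
    rw [ShortComplex.exact_iff_exact_up_to_refinements]
    intro B y (hy : y ≫ ψ = 0)
    obtain ⟨B₁, π₁, _, x, hx⟩ := surjective_up_to_refinements_of_epi (cokernel.π j) y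
    have h1 : (x ≫ S.g) ≫ cokernel.π (image.ι (j ≫ S.g)) = 0 := by
      have : x ≫ cokernel.π j ≫ ψ = 0 := by rw [← reassoc_of% hx, hy, comp_zero]
      simpa [ψ] using this
    obtain ⟨B₂, π₂, _, x', hx'⟩ := surjective_up_to_refinements_of_epi
      (factorThruImage (j ≫ S.g)) (Abelian.monoLift (image.ι (j ≫ S.g)) _ h1)
    have h2 : (π₂ ≫ x - x' ≫ j) ≫ S.g = 0 := by
      have := congrArg (· ≫ image.ι (j ≫ S.g)) hx'
      simp only [Category.assoc, Abelian.monoLift_comp, image.fac] at this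
      simp [this]
    refine ⟨B₂, π₂ ≫ π₁, inferInstance, hS.exact.lift _ h2 ≫ cokernel.π _, ?_⟩
    have h3 := congrArg (· ≫ cokernel.π j) (hS.exact.lift_f _ h2)
    simp only [Category.assoc, Preadditive.sub_comp, cokernel.condition, comp_zero, sub_zero] at h3
    simp [φ, hx, h3]

theorem lengthGE_of_mono [T.IsSerreClass] {n : ℕ} {X Y : C} (f : X ⟶ Y) [Mono f]
    (h : LengthGE T n X) : LengthGE T n Y := by
  cases n with
  | zero => trivial
  | succ n =>
    obtain ⟨A, j, _, hA, hj⟩ := h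
    refine ⟨A, j ≫ f, inferInstance, hA, fun h ↦ hj ?_⟩
    have sq : IsPullback j (𝟙 A) f (j ≫ f) := by
      refine ⟨⟨by simp⟩, ⟨PullbackCone.IsLimit.mk (by simp) (fun s ↦ s.snd) (fun s ↦ ?_) (by simp)
        (fun s m _ h ↦ by simpa using h)⟩⟩
      rw [← cancel_mono f, Category.assoc, s.condition]
    have := Abelian.mono_cokernel_map_of_isPullback sq
    exact T.prop_of_mono (cokernel.map _ _ _ _ sq.w) h

theorem lengthGE_add [T.IsSerreClass] {S : ShortComplex C} (hS : S.ShortExact) {m n : ℕ}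
    (hm : LengthGE T m S.X₁) (hn : LengthGE T n S.X₃) : LengthGE T (m + n) S.X₂ := by
  have := hS.mono_f
  have := hS.epi_g
  induction n generalizing S with
  | zero => exact lengthGE_of_mono T S.f hm
  | succ n ih =>
    obtain ⟨Q, q, _, hQ, hq⟩ := hn
    have hw : pullback.lift S.f (0 : S.X₁ ⟶ Q) (by simp) ≫ pullback.snd S.g q = 0 :=
      pullback.lift_snd _ _ _
    have : Mono (pullback.lift S.f (0 : S.X₁ ⟶ Q) (by simp) : _ ⟶ pullback S.g q) :=
      mono_of_mono_fac (pullback.lift_fst _ _ _)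
    have : Epi (pullback.snd S.g q) := inferInstance
    have hS' := ShortComplex.ShortExact.of_exists_lift _ _ hw fun B x hx ↦ by
      have hx' : (x ≫ pullback.fst S.g q) ≫ S.g = 0 := by
        rw [Category.assoc, pullback.condition, reassoc_of% hx, zero_comp]
      refine ⟨hS.exact.lift _ hx', pullback.hom_ext ?_ ?_⟩
      · rw [Category.assoc, pullback.lift_fst, hS.exact.lift_f]
      · rw [Category.assoc, hw, comp_zero, hx]
    refine ⟨_, pullback.fst S.g q, inferInstance, ih hS' hm hQ inferInstance inferInstance,
      fun h ↦ hq ?_⟩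
    have : Epi (cokernel.map (pullback.fst S.g q) q _ _ pullback.condition) :=
      epi_of_epi_fac (cokernel.π_desc _ _ _)
    exact T.prop_of_epi (cokernel.map (pullback.fst S.g q) q _ _ pullback.condition) h

theorem exists_add_eq_of_lengthGE [T.IsSerreClass] {S : ShortComplex C} (hS : S.ShortExact) {k : ℕ}
    (hk : LengthGE T k S.X₂) : ∃ m n, m + n = k ∧ LengthGE T m S.X₁ ∧ LengthGE T n S.X₃ := by
  induction k generalizing S with
  | zero => exact ⟨0, 0, rfl, trivial, trivial⟩
  | succ k ih =>
    obtain ⟨X', j, _, hX', hj⟩ := hk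
    obtain ⟨A, Q, a, q, i, p, w, _, _, -, -, hS', hT⟩ := hS.exists_restrict T j
    obtain ⟨m, n, rfl, hm, hn⟩ := ih hS' hX'
    by_cases ha : T (cokernel a)
    · exact ⟨m, n + 1, by ring, lengthGE_of_mono T a hm, Q, q, inferInstance, hn,
        fun h ↦ hj (hT ha h)⟩
    · exact ⟨m + 1, n, by ring, ⟨A, a, inferInstance, hm, ha⟩, lengthGE_of_mono T q hn⟩

/-- The length of an object modulo a Serre class `T`: the supremum of the lengths of its chains of
subobjects all of whose successive quotients lie outside `T`. -/
noncomputable def lengthMod (X : C) : ℕ∞ := ⨆ (n : ℕ) (_ : LengthGE T n X), (n : ℕ∞)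

/-- A function on objects with values in `ℕ∞` that is additive on short exact sequences. -/
def IsAdditive (ℓ : C → ℕ∞) : Prop :=
  ∀ S : ShortComplex C, S.ShortExact → ℓ S.X₂ = ℓ S.X₁ + ℓ S.X₃

theorem le_lengthMod {n : ℕ} {X : C} (h : LengthGE T n X) : (n : ℕ∞) ≤ lengthMod T X :=
  le_iSup₂_of_le n h le_rfl

theorem lengthMod_le {X : C} {b : ℕ∞} (h : ∀ n, LengthGE T n X → (n : ℕ∞) ≤ b) :
    lengthMod T X ≤ b :=
  iSup₂_le h

theorem isAdditive_lengthMod [T.IsSerreClass] : IsAdditive (lengthMod T) := by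
  intro S hS
  apply le_antisymm
  · refine lengthMod_le T fun k hk ↦ ?_
    obtain ⟨m, n, rfl, hm, hn⟩ := exists_add_eq_of_lengthGE T hS hk
    rw [Nat.cast_add]
    exact add_le_add (le_lengthMod T hm) (le_lengthMod T hn)
  · unfold lengthMod
    refine ENat.biSup_add_biSup_le' (p := fun n ↦ LengthGE T n S.X₁)
      (q := fun n ↦ LengthGE T n S.X₃) ⟨0, trivial⟩ ⟨0, trivial⟩ fun m hm n hn ↦ ?_
    rw [← Nat.cast_add]
    exact le_lengthMod T (lengthGE_add T hS hm hn)

theorem lengthMod_eq_zero_iff [T.IsSerreClass] (X : C) : lengthMod T X = 0 ↔ T X := by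
  constructor
  · intro h
    by_contra hX
    have h1 : LengthGE T 1 X := ⟨0, 0, inferInstance, trivial, fun h ↦ hX
      (T.prop_of_iso cokernelZeroIsoTarget h)⟩
    simpa [h] using le_lengthMod T h1
  · intro h
    refine le_antisymm (lengthMod_le T fun n hn ↦ ?_) zero_le
    cases n with
    | zero => simp
    | succ n =>
      obtain ⟨A, j, _, -, hj⟩ := hn
      exact absurd (T.prop_of_epi (cokernel.π j) h) hj

theorem lengthMod_le_one [T.IsSerreClass] {X : C}
    (h : ∀ (A : C) (j : A ⟶ X) [Mono j], j ≠ 0 → T (cokernel j)) : lengthMod T X ≤ 1 := by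
  refine lengthMod_le T fun n hn ↦ ?_
  match n, hn with
  | 0, _ => simp
  | 1, _ => simp
  | n + 2, ⟨A, j, _, ⟨B, i, _, _, hi⟩, hj⟩ =>
    have hj0 : j = 0 := by
      by_contra h0
      exact hj (h A j h0)
    have hA : IsZero A := IsZero.of_mono_eq_zero j hj0
    exact absurd (T.prop_of_isZero (hA.of_epi (cokernel.π i))) hi

variable {T} {ℓ : C → ℕ∞}

namespace IsAdditive

theorem of_mono (hℓ : IsAdditive ℓ) {X Y : C} (f : X ⟶ Y) [Mono f] : ℓ X ≤ ℓ Y := by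
  have := hℓ _ (ShortComplex.ShortExact.mk' (ShortComplex.exact_cokernel f) ‹_›
    (inferInstanceAs (Epi (cokernel.π f))))
  exact this ▸ le_self_add

theorem of_epi (hℓ : IsAdditive ℓ) {X Y : C} (f : X ⟶ Y) [Epi f] : ℓ Y ≤ ℓ X := by
  have := hℓ _ (ShortComplex.ShortExact.mk' (ShortComplex.exact_kernel f)
    (inferInstanceAs (Mono (kernel.ι f))) ‹_›)
  exact this ▸ le_add_self

theorem of_iso (hℓ : IsAdditive ℓ) {X Y : C} (e : X ≅ Y) : ℓ X = ℓ Y :=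
  le_antisymm (hℓ.of_mono e.hom) (hℓ.of_epi e.hom)

theorem biprod (hℓ : IsAdditive ℓ) (X Y : C) : ℓ (X ⊞ Y) = ℓ X + ℓ Y :=
  hℓ _ (ShortComplex.Splitting.ofHasBinaryBiproduct X Y).shortExact

theorem kernel_add (hℓ : IsAdditive ℓ) {X Y : C} (f : X ⟶ Y) [Epi f] :
    ℓ (kernel f) + ℓ Y = ℓ X :=
  (hℓ _ (ShortComplex.ShortExact.mk' (ShortComplex.exact_kernel f)
    (inferInstanceAs (Mono (kernel.ι f))) ‹_›)).symm

end IsAdditive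

/-- The objects of finite length modulo a Serre class form a Serre class. -/
theorem isSerreClass_lengthMod_ne_top [T.IsSerreClass] :
    ObjectProperty.IsSerreClass (fun X : C ↦ lengthMod T X ≠ ⊤) where
  exists_zero := ⟨0, isZero_zero C, by
    rw [(lengthMod_eq_zero_iff T _).2 (T.prop_of_isZero (isZero_zero C))]; simp⟩
  prop_of_mono f _ h := ne_top_of_le_ne_top h ((isAdditive_lengthMod T).of_mono f)
  prop_of_epi f _ h := ne_top_of_le_ne_top h ((isAdditive_lengthMod T).of_epi f)
  prop_X₂_of_shortExact hS h₁ h₃ := by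
    rw [isAdditive_lengthMod T _ hS]
    exact WithTop.add_ne_top.2 ⟨h₁, h₃⟩

end Length

end CategoryTheory

/-! ### Lengths of biproducts and of subquotients -/

namespace CategoryTheory

section Biproduct

attribute [local instance] Abelian.hasFiniteBiproducts

variable {C : Type u} [Category.{v} C] [Abelian C] {ℓ : C → ℕ∞}

namespace IsAdditive

theorem eq_zero_of_isZero (hℓ : IsAdditive ℓ) {X Y : C} (hX : IsZero X) (hY : ℓ Y ≠ ⊤) :
    ℓ X = 0 := by
  have h := hℓ.biprod X Y
  have : Mono (biprod.snd : X ⊞ Y ⟶ Y) := by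
    rw [Preadditive.mono_iff_cancel_zero]
    intro Z g hg
    exact biprod.hom_ext _ _ (hX.eq_of_tgt _ _) (by simpa using hg)
  have h' := hℓ.of_mono (biprod.snd : X ⊞ Y ⟶ Y)
  rw [h, ← zero_add (ℓ Y), ← add_assoc, add_zero] at h'
  exact nonpos_iff_eq_zero.1 ((ENat.add_le_add_iff_right hY).1 h')

theorem biproduct_const (hℓ : IsAdditive ℓ) {X : C} (hX : ℓ X ≠ ⊤) (J : Type) [Fintype J] :
    ℓ (⨁ fun _ : J ↦ X) = Fintype.card J * ℓ X := by
  refine Fintype.induction_empty_option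
    (P := fun J _ ↦ ℓ (⨁ fun _ : J ↦ X) = Fintype.card J * ℓ X) ?_ ?_ ?_ J
  · intro J K _ e ih
    let _ := Fintype.ofEquiv K e.symm
    rw [← Fintype.card_congr e, ← ih]
    exact (hℓ.of_iso (biproduct.whiskerEquiv e fun _ ↦ Iso.refl X)).symm
  · refine (hℓ.eq_zero_of_isZero ?_ hX).trans (by simp)
    rw [IsZero.iff_id_eq_zero]
    exact biproduct.hom_ext _ _ fun j ↦ j.elim
  · intro J _ ih
    let p : (⨁ fun _ : Option J ↦ X) ⟶ ⨁ fun _ : J ↦ X :=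
      biproduct.lift fun j ↦ biproduct.π _ (some j)
    have w : biproduct.ι (fun _ : Option J ↦ X) none ≫ p = 0 :=
      biproduct.hom_ext _ _ fun j ↦ by simp [p]
    have : IsSplitEpi p := ⟨⟨⟨biproduct.desc fun j ↦ biproduct.ι (fun _ ↦ X) (some j), by
      classical
      ext i j
      simp [p, biproduct.ι_π]⟩⟩⟩
    have h := hℓ _ (ShortComplex.ShortExact.of_exists_lift _ _ w fun B x hx ↦
      ⟨x ≫ biproduct.π _ none, biproduct.hom_ext _ _ fun j ↦ by
        classical
        cases j with
        | none => simp
        | some j => simpa [p, biproduct.ι_π] using hx =≫ biproduct.π _ j⟩)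
    dsimp only at h
    rw [h, ih, Fintype.card_option]
    push_cast
    ring

/-- If a morphism with image `I` factors through `K`, then `I` is a subquotient of `K`. -/
theorem le_of_factors (hℓ : IsAdditive ℓ) {X I Y K : C} (q : X ⟶ I) (j : I ⟶ Y) [Epi q] [Mono j]
    (u : X ⟶ K) (w : K ⟶ Y) (h : u ≫ w = q ≫ j) : ℓ I ≤ ℓ K := by
  have hu : kernel.ι q ≫ u ≫ factorThruImage w = 0 := by
    simp [← cancel_mono (image.ι w), h]
  have hd : Abelian.epiDesc q (u ≫ factorThruImage w) hu ≫ image.ι w = j := by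
    simp [← cancel_epi q, h]
  have := mono_of_mono_fac hd
  exact (hℓ.of_mono (Abelian.epiDesc q (u ≫ factorThruImage w) hu)).trans
    (hℓ.of_epi (factorThruImage w))

end IsAdditive

end Biproduct
end CategoryTheory

/-! ### Finite approximations of a group and their operators -/

/-- The maps `σ g : V → V` look, at the point `x` and for elements of `F`, like a free right action
of the group `G`. -/
structure IsFreeActionAt {G V : Type*} [Group G] (σ : G → V → V) (F : Finset G) (x : V) :
    Prop where
  one : σ 1 x = x
  mul : ∀ g ∈ F, ∀ h ∈ F, σ h (σ g x) = σ (g * h) x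
  free : ∀ g ∈ F, ∀ h ∈ F, σ g x = σ h x → g = h

/-- If the maps `σ g` look like a free action of `G` at the points of `V₀`, then a proportion
`1 / |F|²` of these points have pairwise disjoint orbits under `F`. -/
theorem exists_separated {G V : Type*} [Group G] [DecidableEq G] [DecidableEq V]
    {σ : G → V → V} {F : Finset G} (hF : ∀ g ∈ F, g⁻¹ ∈ F) (hF1 : 1 ∈ F) {V₀ : Finset V}
    (hσ : ∀ x ∈ V₀, IsFreeActionAt σ F x) :
    ∃ W ⊆ V₀, (∀ x ∈ W, ∀ y ∈ W, ∀ g ∈ F, ∀ h ∈ F, σ g x = σ h y → x = y) ∧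
      V₀.card ≤ W.card * F.card ^ 2 := by
  classical
  let P : Finset V → Prop := fun W ↦
    ∀ x ∈ W, ∀ y ∈ W, ∀ g ∈ F, ∀ h ∈ F, σ g x = σ h y → x = y
  obtain ⟨W, hW, hmax⟩ := (V₀.powerset.filter P).exists_maximal ⟨∅, by simp [P]⟩
  simp only [Finset.mem_filter, Finset.mem_powerset] at hW hmax
  refine ⟨W, hW.1, hW.2, ?_⟩
  have key : V₀ ⊆ W.biUnion fun w ↦ (F ×ˢ F).image fun p ↦ σ p.2 (σ p.1 w) := by
    intro x hx
    obtain ⟨w, hw, g, hg, h, hh, e⟩ : ∃ w ∈ W, ∃ g ∈ F, ∃ h ∈ F, σ g w = σ h x := by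
      by_contra! H
      have hxW : insert x W ⊆ W := by
        refine hmax ⟨Finset.insert_subset hx hW.1, ?_⟩ (Finset.subset_insert _ _)
        intro y hy z hz g hg h hh e
        rcases Finset.mem_insert.1 hy with hyx | hy <;> rcases Finset.mem_insert.1 hz with hzx | hz
        · rw [hyx, hzx]
        · exact absurd (hyx ▸ e.symm) (H z hz h hh g hg)
        · exact absurd (hzx ▸ e) (H y hy g hg h hh)
        · exact hW.2 y hy z hz g hg h hh e
      exact H x (hxW (Finset.mem_insert_self _ _)) 1 hF1 1 hF1 rfl
    simp only [Finset.mem_biUnion, Finset.mem_image, Finset.mem_product, Prod.exists]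
    refine ⟨w, hw, g, h⁻¹, ⟨hg, hF h hh⟩, ?_⟩
    rw [e, (hσ x hx).mul h hh _ (hF h hh), mul_inv_cancel, (hσ x hx).one]
  calc V₀.card ≤ _ := Finset.card_le_card key
    _ ≤ W.card * (F.card * F.card) := Finset.card_biUnion_le_card_mul _ _ _ fun w _ ↦
        Finset.card_image_le.trans (Finset.card_product _ _).le
    _ = _ := by ring

namespace CategoryTheory

attribute [local instance] Abelian.hasFiniteBiproducts

section Operators

variable {C : Type u} [Category.{v} C] [Abelian C] {G : Type*}

/-- The component at `x` of the operator on the sum of copies of `N` indexed by `V` that an element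
`α` of the group ring of `G` over `End N` defines by means of the maps `σ g : V → V`: the element
`m` is sent to the sum of the `α g (m (σ g x))`. -/
noncomputable def rowOperator {V : Type} [Finite V] {N : C} (σ : G → V → V) (x : V) :
    MonoidAlgebra (End N) G →+ ((⨁ fun _ : V ↦ N) ⟶ N) :=
  (Finsupp.liftAddHom (N := ((⨁ fun _ : V ↦ N) ⟶ N)) fun g ↦
    Preadditive.leftComp N (biproduct.π (fun _ : V ↦ N) (σ g x))).comp
      MonoidAlgebra.coeffAddEquiv.toAddMonoidHom

variable {V : Type} [Finite V] {N : C}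

theorem rowOperator_apply (σ : G → V → V) (x : V) (α : MonoidAlgebra (End N) G) :
    rowOperator σ x α = ∑ g ∈ α.coeff.support, biproduct.π (fun _ ↦ N) (σ g x) ≫ α.coeff g :=
  rfl

theorem rowOperator_single (σ : G → V → V) (x : V) (g : G) (a : End N) :
    rowOperator σ x (MonoidAlgebra.single g a) = biproduct.π (fun _ ↦ N) (σ g x) ≫ a := by
  simp [rowOperator]
  rfl

/-- The product in the group ring corresponds to the composition of operators at the points where
the maps `σ g` look like an action. -/
theorem lift_rowOperator_comp_rowOperator [Group G] {σ : G → V → V} {F : Finset G} {x : V}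
    (hσ : IsFreeActionAt σ F x) (α β : MonoidAlgebra (End N) G) (hα : α.coeff.support ⊆ F)
    (hβ : β.coeff.support ⊆ F) :
    biproduct.lift (fun y ↦ rowOperator σ y β) ≫ rowOperator σ x α = rowOperator σ x (α * β) := by
  rw [MonoidAlgebra.mul_def, map_finsuppSum, rowOperator_apply, Preadditive.comp_sum]
  refine Finset.sum_congr rfl fun g hg ↦ ?_
  dsimp only
  rw [map_finsuppSum, biproduct.lift_π_assoc, rowOperator_apply, Preadditive.sum_comp]
  refine Finset.sum_congr rfl fun h hh ↦ ?_
  dsimp only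
  rw [rowOperator_single, hσ.mul g (hα hg) h (hβ hh), Category.assoc]
  rfl

/-- The rank inequality behind the theorem: if `α * β = 1`, then the operator of
`1 - β * α` has small rank, because it takes its values in the kernel of an epimorphism onto the sum
of the copies of `N` indexed by `V₀`; on the other hand its rank is at least `|W|` times the length
of the image of any coefficient. -/
theorem card_mul_length_image_add_le [Group G] {ℓ : C → ℕ∞} (hℓ : IsAdditive ℓ) (hN : ℓ N ≠ ⊤)
    [Fintype V] {σ : G → V → V} {F : Finset G} {V₀ W : Finset V}
    (hσ : ∀ x ∈ V₀, IsFreeActionAt σ F x) (hW₀ : W ⊆ V₀)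
    (hW : ∀ x ∈ W, ∀ y ∈ W, ∀ g ∈ F, ∀ h ∈ F, σ g x = σ h y → x = y)
    {α β : MonoidAlgebra (End N) G} (hαβ : α * β = 1) (hα : α.coeff.support ⊆ F)
    (hβ : β.coeff.support ⊆ F) (he : (1 - β * α).coeff.support ⊆ F) {g : G} (hg : g ∈ F) :
    W.card * ℓ (image ((1 - β * α).coeff g : N ⟶ N)) + V₀.card * ℓ N ≤ Fintype.card V * ℓ N := by
  classical
  set e := 1 - β * α with he_def
  have hαe : α * e = 0 := by rw [he_def, mul_sub, ← mul_assoc, hαβ]; simp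
  let A : (⨁ fun _ : V ↦ N) ⟶ ⨁ fun _ : V₀ ↦ N := biproduct.lift fun x ↦ rowOperator σ x.1 α
  have hA : Epi A := by
    have h : biproduct.lift (fun y ↦ rowOperator σ y β) ≫ A =
        biproduct.lift fun x : V₀ ↦ biproduct.π (fun _ ↦ N) x.1 := by
      refine biproduct.hom_ext _ _ fun x ↦ ?_
      rw [Category.assoc, biproduct.lift_π, biproduct.lift_π,
        lift_rowOperator_comp_rowOperator (hσ _ x.2) α β hα hβ, hαβ, MonoidAlgebra.one_def,
        rowOperator_single, (hσ _ x.2).one]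
      exact Category.comp_id _
    have : IsSplitEpi (biproduct.lift fun x : V₀ ↦ biproduct.π (fun _ : V ↦ N) x.1) :=
      ⟨⟨⟨biproduct.desc fun x ↦ biproduct.ι (fun _ ↦ N) x.1, by
        ext i j
        simp [biproduct.ι_π]⟩⟩⟩
    exact epi_of_epi_fac h
  have hE : biproduct.lift (fun y ↦ rowOperator σ y e) ≫ A = 0 := by
    refine biproduct.hom_ext _ _ fun x ↦ ?_
    rw [Category.assoc, biproduct.lift_π, lift_rowOperator_comp_rowOperator (hσ _ x.2) α e hα he,
      hαe, map_zero, zero_comp]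
  let f : N ⟶ N := e.coeff g
  have hfac : (biproduct.desc (fun w : W ↦ biproduct.ι (fun _ : V ↦ N) (σ g w.1)) ≫
      kernel.lift A _ hE) ≫ (kernel.ι A ≫ biproduct.lift fun w : W ↦ biproduct.π _ w.1) =
      biproduct.map (fun _ : W ↦ factorThruImage f) ≫ biproduct.map fun _ : W ↦ image.ι f := by
    ext w' w
    have h1 : biproduct.ι (fun _ : V ↦ N) (σ g w.1) ≫ rowOperator σ w'.1 e =
        if w = w' then f else 0 := by
      rw [rowOperator_apply, Preadditive.comp_sum]
      split_ifs with hww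
      · subst hww
        rw [Finset.sum_eq_single g]
        · simp [f]
        · intro h hh hgh
          rw [biproduct.ι_π_ne_assoc, zero_comp]
          exact fun H ↦ hgh ((hσ _ (hW₀ w.2)).free _ (he hh) _ hg H.symm)
        · intro h
          rw [show (e.coeff g : N ⟶ N) = 0 from Finsupp.notMem_support_iff.1 h, comp_zero,
            comp_zero]
      · refine Finset.sum_eq_zero fun h hh ↦ ?_
        rw [biproduct.ι_π_ne_assoc, zero_comp]
        exact fun H ↦ hww (Subtype.ext (hW _ w.2 _ w'.2 g hg h (he hh) H))
    by_cases hww : w = w'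
    · subst hww
      simp [h1]
    · simp [h1, hww, biproduct.ι_π_ne_assoc _ hww]
  have h1 := hℓ.le_of_factors _ _ _ _ hfac
  have hfN : ℓ (image f) ≠ ⊤ := ne_top_of_le_ne_top hN (hℓ.of_mono (image.ι f))
  rw [hℓ.biproduct_const hfN, Fintype.card_coe] at h1
  have h2 := hℓ.kernel_add A
  rw [hℓ.biproduct_const hN, hℓ.biproduct_const hN, Fintype.card_coe] at h2
  rw [← h2]
  gcongr

end Operators

end CategoryTheory

/-! ### Sofic groups -/

namespace LabeledDigraph

theorem mem_neighborhood_two {V B : Type*} (Γ : LabeledDigraph V B) (x y : V) :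
    y ∈ Γ.neighborhood 2 x ↔ y = x ∨ Γ.Adj x y ∨ ∃ z, Γ.Adj x z ∧ Γ.Adj z y := by
  constructor
  · rintro ⟨m, hm, h⟩
    interval_cases m
    · exact Or.inl h.symm
    · obtain ⟨_, rfl, h⟩ := h
      exact Or.inr (Or.inl h)
    · obtain ⟨z, ⟨_, rfl, h⟩, h'⟩ := h
      exact Or.inr (Or.inr ⟨z, h, h'⟩)
  · rintro (rfl | h | ⟨z, h, h'⟩)
    · exact ⟨0, by omega, rfl⟩
    · exact ⟨1, by omega, x, rfl, h⟩
    · exact ⟨2, le_rfl, z, ⟨x, rfl, h⟩, h'⟩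

open scoped Pointwise

variable {G : Type*} [Group G] [DecidableEq G] {B : Finset G} {V : Type*}

theorem mem_neighborhood_two_cayley (hB : 1 ∈ B) (x y : G) :
    y ∈ (cayley G B).neighborhood 2 x ↔ x⁻¹ * y ∈ B * B := by
  rw [mem_neighborhood_two, Finset.mem_mul]
  constructor
  · rintro (rfl | h | ⟨z, h, h'⟩)
    · exact ⟨1, hB, 1, hB, by group⟩
    · exact ⟨1, hB, _, h, by group⟩
    · exact ⟨_, h, _, h', by group⟩
  · rintro ⟨a, ha, b, hb, e⟩
    refine Or.inr (Or.inr ⟨x * a, ?_, ?_⟩)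
    · change x⁻¹ * (x * a) ∈ B
      simpa using ha
    · change (x * a)⁻¹ * y ∈ B
      rwa [mul_inv_rev, mul_assoc, ← e, inv_mul_cancel_left]

/-- An isomorphism of the neighborhood of a vertex `x` with the neighborhood of `1` in a Cayley
graph need not map `x` to `1`. It does so after a left translation, which preserves the finite
neighborhood of `1`; the inverse of the result is `τ`. -/
theorem exists_rooted (hB : 1 ∈ B) (Γ : LabeledDigraph V B) (x : V)
    (φ : Iso (Γ.induce (Γ.neighborhood 2 x))
      ((cayley G B).induce ((cayley G B).neighborhood 2 1))) :
    ∃ τ : G → V, τ 1 = x ∧ Set.InjOn τ ↑(B * B) ∧ ∀ h ∈ B, ∀ b : B, ∀ z : V,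
      (∃ e : Γ.Adj (τ h) z, Γ.label _ _ e = b) ↔ z = τ (h * b) := by
  classical
  have hx : x ∈ Γ.neighborhood 2 x := (mem_neighborhood_two _ _ _).2 (Or.inl rfl)
  have hK (u : G) : u ∈ (cayley G B).neighborhood 2 1 ↔ u ∈ B * B := by
    simpa using mem_neighborhood_two_cayley hB 1 u
  set c : G := (φ.toFun ⟨x, hx⟩ : G)
  -- The neighborhood of `1` is contained in that of `c`, and both have the same cardinality.
  have hsub : B * B ⊆ c • (B * B) := by
    intro u hu
    obtain ⟨⟨y, hy⟩, hyu⟩ := φ.toEquiv.surjective ⟨u, (hK u).2 hu⟩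
    have hyu' : (φ.toFun ⟨y, hy⟩ : G) = u := congrArg Subtype.val hyu
    rw [← Finset.inv_smul_mem_iff, smul_eq_mul, ← mem_neighborhood_two_cayley hB c u,
      mem_neighborhood_two]
    rcases (mem_neighborhood_two _ _ _).1 hy with rfl | h | ⟨z, h, h'⟩
    · exact Or.inl hyu'.symm
    · have := (φ.adj_iff ⟨x, hx⟩ ⟨y, hy⟩).1 h
      rw [← hyu']
      exact Or.inr (Or.inl this)
    · have hz : z ∈ Γ.neighborhood 2 x := (mem_neighborhood_two _ _ _).2 (Or.inr (Or.inl h))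
      have h1 := (φ.adj_iff ⟨x, hx⟩ ⟨z, hz⟩).1 h
      have h2 := (φ.adj_iff ⟨z, hz⟩ ⟨y, hy⟩).1 h'
      rw [← hyu']
      exact Or.inr (Or.inr ⟨_, h1, h2⟩)
  have heq : B * B = c • (B * B) :=
    Finset.eq_of_subset_of_card_le hsub (Finset.card_smul_finset _ _).le
  have hcK (u : G) : c * u ∈ B * B ↔ u ∈ B * B := by
    have := Finset.smul_mem_smul_finset_iff (s := B * B) (b := u) c
    rwa [← heq, smul_eq_mul] at this
  have hBK {b : G} (hb : b ∈ B) : b ∈ B * B := Finset.mem_mul.2 ⟨1, hB, b, hb, one_mul b⟩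
  let τ (u : G) : V :=
    if hu : c * u ∈ (cayley G B).neighborhood 2 1 then φ.toEquiv.symm ⟨c * u, hu⟩ else x
  have hτ {u : G} (hu : u ∈ B * B) : ∃ hy : τ u ∈ Γ.neighborhood 2 x,
      (φ.toFun ⟨τ u, hy⟩ : G) = c * u := by
    have hu' : c * u ∈ (cayley G B).neighborhood 2 1 := (hK _).2 ((hcK u).2 hu)
    have e : τ u = φ.toEquiv.symm ⟨c * u, hu'⟩ := dif_pos hu'
    rw [e]
    refine ⟨Subtype.coe_prop _, ?_⟩
    exact congrArg Subtype.val (φ.toEquiv.apply_symm_apply ⟨c * u, hu'⟩)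
  have hτ' {y : V} (hy : y ∈ Γ.neighborhood 2 x) {u : G} (hu : u ∈ B * B)
      (h : (φ.toFun ⟨y, hy⟩ : G) = c * u) : y = τ u := by
    obtain ⟨hz, hzu⟩ := hτ hu
    exact congrArg Subtype.val
      (φ.toEquiv.injective (a₁ := ⟨y, hy⟩) (a₂ := ⟨τ u, hz⟩) (Subtype.ext (h.trans hzu.symm)))
  have hτ1 : τ 1 = x := (hτ' hx (hBK hB) (by rw [mul_one])).symm
  have hadj {u w : G} (hu : u ∈ B * B) (hw : w ∈ B * B) (h : u⁻¹ * w ∈ B) :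
      ∃ e : Γ.Adj (τ u) (τ w), Γ.label _ _ e = ⟨u⁻¹ * w, h⟩ := by
    obtain ⟨hy, hyu⟩ := hτ hu
    obtain ⟨hz, hzw⟩ := hτ hw
    have key : (φ.toFun ⟨τ u, hy⟩ : G)⁻¹ * (φ.toFun ⟨τ w, hz⟩ : G) = u⁻¹ * w := by
      rw [hyu, hzw]; group
    have e : (Γ.induce (Γ.neighborhood 2 x)).Adj ⟨τ u, hy⟩ ⟨τ w, hz⟩ := by
      rw [φ.adj_iff]
      change (φ.toFun ⟨τ u, hy⟩ : G)⁻¹ * (φ.toFun ⟨τ w, hz⟩ : G) ∈ B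
      rwa [key]
    exact ⟨e, (φ.label_eq _ _ e).symm.trans (Subtype.ext key)⟩
  refine ⟨τ, hτ1, fun u hu w hw e ↦ ?_, fun h hh b z ↦ ⟨?_, ?_⟩⟩
  · obtain ⟨hy, hyu⟩ := hτ hu
    obtain ⟨hz, hzw⟩ := hτ hw
    have : φ.toFun ⟨τ u, hy⟩ = φ.toFun ⟨τ w, hz⟩ := by congr 2
    exact mul_left_cancel (hyu.symm.trans ((congrArg Subtype.val this).trans hzw))
  · rintro ⟨e, rfl⟩
    have hxh : Γ.Adj x (τ h) := by
      obtain ⟨e', -⟩ := hadj (hBK hB) (hBK hh) (by simpa using hh)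
      rwa [hτ1] at e'
    have hz : z ∈ Γ.neighborhood 2 x := (mem_neighborhood_two _ _ _).2 (Or.inr (Or.inr ⟨_, hxh, e⟩))
    obtain ⟨hy, hyu⟩ := hτ (hBK hh)
    have e' : (Γ.induce (Γ.neighborhood 2 x)).Adj ⟨τ h, hy⟩ ⟨z, hz⟩ := e
    have hl : ((Γ.label _ _ e : B) : G) = (c * h)⁻¹ * (φ.toFun ⟨z, hz⟩ : G) := by
      rw [← hyu]
      exact (congrArg Subtype.val (φ.label_eq _ _ e')).symm
    refine hτ' hz (Finset.mul_mem_mul hh (Subtype.coe_prop _)) ?_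
    rw [hl]
    group
  · rintro rfl
    obtain ⟨e, he⟩ := hadj (hBK hh) (Finset.mul_mem_mul hh b.2) (by simp)
    exact ⟨e, he.trans (Subtype.ext (by simp))⟩

end LabeledDigraph

open scoped Pointwise in
/-- A finitely generated sofic group has finite approximations by maps that look like a free
action on `F`. The Cayley graph of `F * F` is used, so that each product of two elements of
`F` is the label of an edge. -/
theorem IsSoficFG.exists_isFreeActionAt {G : Type*} [Group G] [DecidableEq G] (hG : IsSoficFG G)
    {F : Finset G} (hF : ∀ g ∈ F, g⁻¹ ∈ F) (hF1 : 1 ∈ F)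
    (hgen : Subgroup.closure (F : Set G) = ⊤) {ε : ℝ} (hε : 0 < ε) (hε1 : ε < 1) :
    ∃ (V : Type) (_ : Fintype V) (_ : Nonempty V) (V₀ : Finset V) (σ : G → V → V),
      (1 - ε) * (Fintype.card V : ℝ) ≤ (V₀.card : ℝ) ∧ ∀ x ∈ V₀, IsFreeActionAt σ F x := by
  classical
  have hFB : F ⊆ F * F := fun g hg ↦ Finset.mem_mul.2 ⟨1, hF1, g, hg, one_mul g⟩
  obtain ⟨V, i, hV, Γ, V₀, hcard, hV₀⟩ := hG (F * F) (by
      intro b hb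
      obtain ⟨g, hg, h, hh, rfl⟩ := Finset.mem_mul.1 hb
      exact Finset.mem_mul.2 ⟨h⁻¹, hF h hh, g⁻¹, hF g hg, (mul_inv_rev g h).symm⟩)
    (top_le_iff.1 (hgen ▸ Subgroup.closure_mono (Finset.coe_subset.2 hFB))) ε hε hε1 2
  let σ (g : G) (y : V) : V :=
    if h : ∃ hg : g ∈ F * F, ∃ z, ∃ e : Γ.Adj y z, Γ.label y z e = ⟨g, hg⟩ then h.choose_spec.choose
    else y
  refine ⟨V, i, hV, V₀, σ, hcard, fun x hx ↦ ?_⟩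
  obtain ⟨φ⟩ := hV₀ x hx
  obtain ⟨τ, hτ1, hinj, hτ⟩ := LabeledDigraph.exists_rooted (hFB hF1) Γ x φ
  have hσ {h b : G} (hh : h ∈ F * F) (hb : b ∈ F * F) : σ b (τ h) = τ (h * b) := by
    have H : ∃ hb : b ∈ F * F, ∃ z, ∃ e : Γ.Adj (τ h) z, Γ.label (τ h) z e = ⟨b, hb⟩ :=
      ⟨hb, _, (hτ h hh ⟨b, hb⟩ _).2 rfl⟩
    rw [show σ b (τ h) = H.choose_spec.choose from dif_pos H]
    exact (hτ h hh ⟨b, hb⟩ _).1 H.choose_spec.choose_spec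
  have hσ1 {g : G} (hg : g ∈ F * F) : σ g x = τ g := by
    rw [← hτ1, hσ (hFB hF1) hg, one_mul]
  have hFBB {g : G} (hg : g ∈ F * F) : g ∈ (F * F) * (F * F) :=
    Finset.mem_mul.2 ⟨1, hFB hF1, g, hg, one_mul g⟩
  refine ⟨by rw [hσ1 (hFB hF1), hτ1], fun g hg h hh ↦ ?_, fun g hg h hh e ↦ ?_⟩
  · rw [hσ1 (hFB hg), hσ (hFB hg) (hFB hh), hσ1 (Finset.mul_mem_mul hg hh)]
  · rw [hσ1 (hFB hg), hσ1 (hFB hh)] at e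
    exact hinj (hFBB (hFB hg)) (hFBB (hFB hh)) e

theorem IsSofic.exists_isFreeActionAt {G : Type*} [Group G] [DecidableEq G] (hG : IsSofic G)
    {F : Finset G} (hF : ∀ g ∈ F, g⁻¹ ∈ F) (hF1 : 1 ∈ F) {ε : ℝ} (hε : 0 < ε) (hε1 : ε < 1) :
    ∃ (V : Type) (_ : Fintype V) (_ : Nonempty V) (V₀ : Finset V) (σ : G → V → V),
      (1 - ε) * (Fintype.card V : ℝ) ≤ (V₀.card : ℝ) ∧ ∀ x ∈ V₀, IsFreeActionAt σ F x := by
  classical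
  let H := Subgroup.closure (F : Set G)
  have hFH {g : G} (hg : g ∈ F) : g ∈ H := Subgroup.subset_closure hg
  obtain ⟨V, i, hV, V₀, σ, hcard, hσ⟩ :=
    (hG H ⟨F, rfl⟩).exists_isFreeActionAt (F := F.subtype (· ∈ H))
    (fun g hg ↦ by simpa using hF _ (Finset.mem_subtype.1 hg)) (by simpa using hF1)
    (by
      convert! Subgroup.closure_closure_coe_preimage (k := (F : Set G)) using 2
      ext g
      simp) hε hε1
  refine ⟨V, i, hV, V₀, fun g ↦ if h : g ∈ H then σ ⟨g, h⟩ else id, hcard, fun x hx ↦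
    ⟨?_, fun g hg h hh ↦ ?_, fun g hg h hh e ↦ ?_⟩⟩
  · simpa using! (hσ x hx).one
  · have := (hσ x hx).mul ⟨g, hFH hg⟩ (Finset.mem_subtype.2 hg) ⟨h, hFH hh⟩
      (Finset.mem_subtype.2 hh)
    simpa [hFH hg, hFH hh, H.mul_mem (hFH hg) (hFH hh)] using! this
  · simp only [hFH hg, hFH hh, dif_pos] at e
    exact congrArg Subtype.val ((hσ x hx).free ⟨g, hFH hg⟩ (Finset.mem_subtype.2 hg) ⟨h, hFH hh⟩
      (Finset.mem_subtype.2 hh) e)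

/-! ### Noetherian objects -/

namespace CategoryTheory

attribute [local instance] Abelian.hasFiniteBiproducts

section Noetherian

variable {C : Type u} [Category.{v} C] [Abelian C]

/-- For a Serre class `P`, a Noetherian object has a largest subobject in `P`. -/
theorem exists_largest_subobject (P : ObjectProperty C) [P.IsSerreClass] (M : C)
    [IsNoetherianObject M] :
    ∃ (X : C) (i : X ⟶ M), Mono i ∧ P X ∧ ∀ (Z : C) (z : Z ⟶ M), P Z → ∃ y, y ≫ i = z := by
  obtain ⟨S, hS, hmax⟩ := (wellFounded_gt (α := Subobject M)).has_min {S | P (Subobject.underlying.obj S)}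
    ⟨⊥, P.prop_of_isZero ((isZero_zero C).of_iso Subobject.botCoeIsoZero)⟩
  refine ⟨S, S.arrow, inferInstance, hS, fun Z z hZ ↦ ?_⟩
  let d := biprod.desc S.arrow z
  have hle : S ≤ Subobject.mk (image.ι d) :=
    Subobject.le_mk_of_comm (biprod.inl ≫ factorThruImage d) (by simp [d])
  have hP : P (Subobject.mk (image.ι d) : C) :=
    P.prop_of_iso (Subobject.underlyingIso _).symm
      (P.prop_of_epi (factorThruImage d) (P.prop_biprod hS hZ))
  have heq : Subobject.mk (image.ι d) ≤ S := by
    by_contra h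
    exact hmax _ hP (lt_of_le_not_ge hle h)
  exact ⟨biprod.inr ≫ factorThruImage d ≫ Subobject.ofMkLE _ _ heq, by simp [d]⟩

/-- If a Noetherian object is outside of a Serre class `T`, then it has a quotient that is not
in `T` although all its proper quotients are. -/
theorem exists_minimal_quotient (T : ObjectProperty C) [T.IsSerreClass] {E : C}
    [IsNoetherianObject E] (hE : ¬ T E) :
    ∃ (Q : C) (p : E ⟶ Q), Epi p ∧ ¬ T Q ∧
      ∀ (A : C) (j : A ⟶ Q) [Mono j], j ≠ 0 → T (cokernel j) := by
  obtain ⟨S, hS, hmax⟩ := (wellFounded_gt (α := Subobject E)).has_min {S | ¬ T (cokernel S.arrow)}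
    ⟨⊥, fun h ↦ hE <| by
      have : IsIso (cokernel.π (⊥ : Subobject E).arrow) := by
        rw [Subobject.bot_arrow]; infer_instance
      exact T.prop_of_iso (asIso (cokernel.π (⊥ : Subobject E).arrow)).symm h⟩
  refine ⟨cokernel S.arrow, cokernel.π _, inferInstance, hS, fun A j _ hj ↦ ?_⟩
  by_contra hT
  let S' := kernelSubobject (cokernel.π S.arrow ≫ cokernel.π j)
  have hle : S ≤ S' := le_kernelSubobject _ _ (by simp)
  refine hmax S' (fun h ↦ hT ?_) (lt_of_le_not_ge hle fun hge ↦ hj ?_)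
  · have : Epi (cokernel.desc S'.arrow (cokernel.π S.arrow ≫ cokernel.π j)
        (kernelSubobject_arrow_comp _)) := epi_of_epi_fac (cokernel.π_desc _ _ _)
    exact T.prop_of_epi (cokernel.desc S'.arrow (cokernel.π S.arrow ≫ cokernel.π j)
        (kernelSubobject_arrow_comp _)) h
  · obtain ⟨B, π, _, x, hx⟩ := surjective_up_to_refinements_of_epi (cokernel.π S.arrow) j
    have h0 : x ≫ cokernel.π S.arrow ≫ cokernel.π j = 0 := by rw [← reassoc_of% hx]; simp
    have hxS : x = (factorThruKernelSubobject _ x h0 ≫ Subobject.ofLE S' S hge) ≫ S.arrow := by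
      simp [S']
    rw [← cancel_epi π, hx, hxS, Category.assoc, cokernel.condition, comp_zero, comp_zero]

/-- An inclusion `S ≤ S'` of subobjects of `X ⊞ Y` is an equality if `S` and `S'` have the same
intersection with `X` and the same image in `Y`. -/
theorem le_of_kernelSubobject_le_of_imageSubobject_le {X Y : C} {S S' : Subobject (X ⊞ Y)}
    (h : S ≤ S')
    (h₁ : kernelSubobject (biprod.inl ≫ cokernel.π S'.arrow) ≤
      kernelSubobject (biprod.inl ≫ cokernel.π S.arrow))
    (h₂ : imageSubobject (S'.arrow ≫ biprod.snd) ≤ imageSubobject (S.arrow ≫ biprod.snd)) :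
    S' ≤ S := by
  suffices hS : S'.arrow ≫ cokernel.π S.arrow = 0 from
    Subobject.le_of_comm (Abelian.monoLift S.arrow _ hS) (Abelian.monoLift_comp _ _ _)
  obtain ⟨B, π, _, x, hx⟩ := surjective_up_to_refinements_of_epi
    (factorThruImageSubobject (S.arrow ≫ biprod.snd))
    (factorThruImageSubobject (S'.arrow ≫ biprod.snd) ≫ Subobject.ofLE _ _ h₂)
  have hx' : π ≫ S'.arrow ≫ biprod.snd = x ≫ S.arrow ≫ biprod.snd := by
    simpa using hx =≫ (imageSubobject (S.arrow ≫ biprod.snd)).arrow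
  -- The difference of `S'.arrow` and its lift to `S` lies in the intersection of `S'` with `X`.
  let d : B ⟶ X := (π ≫ S'.arrow - x ≫ S.arrow) ≫ biprod.fst
  have hd : d ≫ biprod.inl = π ≫ S'.arrow - x ≫ S.arrow := by
    apply biprod.hom_ext
    · simp [d]
    · simp [hx']
  have hd' : d ≫ biprod.inl ≫ cokernel.π S'.arrow = 0 := by
    have : S.arrow ≫ cokernel.π S'.arrow = 0 := by
      rw [← Subobject.ofLE_arrow h, Category.assoc, cokernel.condition, comp_zero]
    rw [reassoc_of% hd, Preadditive.sub_comp, Category.assoc, Category.assoc, this,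
      cokernel.condition, comp_zero, comp_zero, sub_zero]
  have hd'' : d ≫ biprod.inl ≫ cokernel.π S.arrow = 0 := by
    have : d = factorThruKernelSubobject _ d hd' ≫ Subobject.ofLE _ _ h₁ ≫
        (kernelSubobject (biprod.inl ≫ cokernel.π S.arrow)).arrow := by simp
    rw [this]
    simp only [Category.assoc, kernelSubobject_arrow_comp, comp_zero]
  rw [reassoc_of% hd, Preadditive.sub_comp, Category.assoc, Category.assoc, cokernel.condition,
    comp_zero, sub_zero] at hd''
  rwa [← cancel_epi π, comp_zero]

/-- Noetherian objects are closed under binary biproducts. -/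
theorem isNoetherianObject_biprod (X Y : C) [IsNoetherianObject X] [IsNoetherianObject Y] :
    IsNoetherianObject (X ⊞ Y) := by
  rw [isNoetherianObject_iff_monotone_chain_condition]
  intro f
  obtain ⟨n₁, h₁⟩ := monotone_chain_condition_of_isNoetherianObject (X := X)
    { toFun n := kernelSubobject (biprod.inl ≫ cokernel.π (f n).arrow)
      monotone' m n hmn := by
        refine le_kernelSubobject _ _ ?_
        have : (f m).arrow ≫ cokernel.π (f n).arrow = 0 := by
          rw [← Subobject.ofLE_arrow (f.monotone hmn), Category.assoc, cokernel.condition,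
            comp_zero]
        dsimp only
        rw [← cokernel.π_desc _ _ this, ← Category.assoc biprod.inl, kernelSubobject_arrow_comp_assoc, zero_comp] }
  obtain ⟨n₂, h₂⟩ := monotone_chain_condition_of_isNoetherianObject (X := Y)
    { toFun n := imageSubobject ((f n).arrow ≫ biprod.snd)
      monotone' m n hmn := by
        dsimp only
        rw [← Subobject.ofLE_arrow (f.monotone hmn), Category.assoc]
        exact imageSubobject_comp_le _ _ }
  refine ⟨max n₁ n₂, fun m hm ↦ le_antisymm (f.monotone hm) ?_⟩
  refine le_of_kernelSubobject_le_of_imageSubobject_le (f.monotone hm) ?_ ?_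
  · exact ((h₁ m (le_of_max_le_left hm)).symm.trans (h₁ _ (le_max_left _ _))).le
  · exact ((h₂ m (le_of_max_le_right hm)).symm.trans (h₂ _ (le_max_right _ _))).le

theorem isNoetherianObject_biproduct_const (X : C) [IsNoetherianObject X] (n : ℕ) :
    IsNoetherianObject (⨁ fun _ : Fin n ↦ X) := by
  induction n with
  | zero =>
    refine isNoetherianObject_of_isZero ?_
    rw [IsZero.iff_id_eq_zero]
    exact biproduct.hom_ext _ _ fun j ↦ j.elim0
  | succ n ih =>
    have := isNoetherianObject_biprod X (⨁ fun _ : Fin n ↦ X)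
    have hmono : Mono (biprod.lift (biproduct.π (fun _ : Fin (n + 1) ↦ X) 0)
        (biproduct.lift fun i : Fin n ↦ biproduct.π (fun _ : Fin (n + 1) ↦ X) i.succ)) := by
      rw [Preadditive.mono_iff_cancel_zero]
      intro B x hx
      refine biproduct.hom_ext _ _ fun i ↦ ?_
      rw [zero_comp]
      cases i using Fin.cases with
      | zero => simpa using hx =≫ biprod.fst
      | succ i => simpa using (hx =≫ biprod.snd) =≫ biproduct.π _ i
    exact isNoetherianObject_of_mono (biprod.lift (biproduct.π (fun _ : Fin (n + 1) ↦ X) 0)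
      (biproduct.lift fun i : Fin n ↦ biproduct.π (fun _ : Fin (n + 1) ↦ X) i.succ))

end Noetherian

section Zorn

variable {C : Type u} [Category.{v} C] [Abelian C]

/-- A nonzero Noetherian object `E` has finite nonzero length modulo some Serre class. One takes
a Serre class `T` that is maximal among those that do not contain `E`. The objects of finite length
modulo `T` form a Serre class, and it is larger than `T` because it contains a quotient `Q` of `E`
outside of `T` all of whose proper quotients belong to `T`; hence it contains `E`. -/
theorem exists_serreClass_lengthMod_ne_top (E : C) [IsNoetherianObject E] (hE : ¬ IsZero E) :
    ∃ T : ObjectProperty C, T.IsSerreClass ∧ ¬ T E ∧ lengthMod T E ≠ ⊤ := by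
  obtain ⟨T, -, hT, hmax⟩ := zorn_le_nonempty₀ {T : ObjectProperty C | T.IsSerreClass ∧ ¬ T E}
    (fun c hc hchain T₀ hT₀ ↦ by
      refine ⟨fun X ↦ ∃ T ∈ c, T X, ⟨?_, ?_⟩, fun T hT X hX ↦ ⟨T, hT, hX⟩⟩
      · have hs := fun T hT ↦ (hc (a := T) hT).1
        refine { exists_zero := ?_, prop_of_mono := ?_, prop_of_epi := ?_,
                 prop_X₂_of_shortExact := ?_ }
        · have := hs T₀ hT₀
          exact ⟨_, isZero_zero C, T₀, hT₀, T₀.prop_of_isZero (isZero_zero C)⟩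
        · rintro X Y f _ ⟨T, hT, h⟩
          have := hs T hT
          exact ⟨T, hT, T.prop_of_mono f h⟩
        · rintro X Y f _ ⟨T, hT, h⟩
          have := hs T hT
          exact ⟨T, hT, T.prop_of_epi f h⟩
        · rintro S hS ⟨T₁, hT₁, h₁⟩ ⟨T₂, hT₂, h₂⟩
          have := hs T₁ hT₁
          have := hs T₂ hT₂
          rcases hchain.total hT₁ hT₂ with h | h
          · exact ⟨T₂, hT₂, T₂.prop_X₂_of_shortExact hS (h _ h₁) h₂⟩
          · exact ⟨T₁, hT₁, T₁.prop_X₂_of_shortExact hS h₁ (h _ h₂)⟩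
      · rintro ⟨T, hT, h⟩
        exact (hc hT).2 h) IsZero ⟨inferInstance, hE⟩
  have := hT.1
  refine ⟨T, hT.1, hT.2, ?_⟩
  by_contra hlen
  obtain ⟨Q, p, _, hQ, hmin⟩ := exists_minimal_quotient T hT.2
  have hQ1 := lengthMod_le_one T hmin
  refine hQ (hmax (y := fun X ↦ lengthMod T X ≠ ⊤)
    ⟨isSerreClass_lengthMod_ne_top, not_not.2 hlen⟩ (fun X hX ↦ ?_) Q ?_)
  · change lengthMod T X ≠ ⊤
    rw [(lengthMod_eq_zero_iff T X).2 hX]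
    exact ENat.zero_ne_top
  · exact ne_top_of_le_ne_top ENat.one_ne_top hQ1

end Zorn

end CategoryTheory

/-! ### Group rings over endomorphism rings of Noetherian objects -/

namespace CategoryTheory

attribute [local instance] Abelian.hasFiniteBiproducts

section FactorsThrough

variable {C : Type u} [Category.{v} C]

/-- A morphism factors through an object with the property `T`. -/
def FactorsThrough (T : ObjectProperty C) {X Y : C} (f : X ⟶ Y) : Prop :=
  ∃ (Z : C) (_ : T Z) (u : X ⟶ Z) (w : Z ⟶ Y), u ≫ w = f

namespace FactorsThrough

variable {T : ObjectProperty C} {X Y Z : C}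

theorem comp_right {f : X ⟶ Y} (hf : FactorsThrough T f) (g : Y ⟶ Z) :
    FactorsThrough T (f ≫ g) := by
  obtain ⟨A, hA, u, w, rfl⟩ := hf
  exact ⟨A, hA, u, w ≫ g, by simp⟩

theorem comp_left {f : Y ⟶ Z} (hf : FactorsThrough T f) (g : X ⟶ Y) :
    FactorsThrough T (g ≫ f) := by
  obtain ⟨A, hA, u, w, rfl⟩ := hf
  exact ⟨A, hA, g ≫ u, w, by simp⟩

end FactorsThrough

end FactorsThrough

section GroupRing

variable {C : Type u} [Category.{v} C] [Abelian C]

open scoped Pointwise in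
/-- Over an object `N` of finite length, a left inverse in the group ring of a sofic group is a
right inverse up to morphisms of length zero. -/
theorem length_image_coeff_eq_zero {G : Type*} [Group G] (hG : IsSofic G) {N : C} {ℓ : C → ℕ∞}
    (hℓ : IsAdditive ℓ) (hN : ℓ N ≠ ⊤) {α β : MonoidAlgebra (End N) G} (hαβ : α * β = 1) (g : G) :
    ℓ (image ((1 - β * α).coeff g : N ⟶ N)) = 0 := by
  classical
  by_contra hI
  let F₀ := α.coeff.support ∪ β.coeff.support ∪ (1 - β * α).coeff.support ∪ {1, g}
  let F := F₀ ∪ F₀⁻¹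
  have hF₀ : F₀ ⊆ F := Finset.subset_union_left
  have hF (h : G) (hh : h ∈ F) : h⁻¹ ∈ F := by
    simp only [F, Finset.mem_union, Finset.mem_inv', inv_inv] at hh ⊢
    exact hh.symm
  have hF1 : 1 ∈ F := hF₀ (by simp [F₀])
  have hFg : g ∈ F := hF₀ (by simp [F₀])
  obtain ⟨L, hL⟩ := ENat.ne_top_iff_exists.1 hN
  let D : ℕ := F.card ^ 2
  have hpos : (0 : ℝ) < 2 + D * L := by positivity
  -- With this choice, `(1 - ε) * (1 + D * L) > D * L`.
  obtain ⟨V, _, _, V₀, σ, hcard, hσ⟩ := hG.exists_isFreeActionAt hF hF1 (ε := (2 + D * L : ℝ)⁻¹)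
    (by positivity) (inv_lt_one_of_one_lt₀ (by
      have : (0 : ℝ) ≤ D * L := by positivity
      linarith))
  obtain ⟨W, hW₀, hW, hWcard⟩ := exists_separated hF hF1 hσ
  have key := card_mul_length_image_add_le hℓ hN hσ hW₀ hW hαβ
    (fun x hx ↦ hF₀ (by simp only [F₀, Finset.mem_union]; tauto))
    (fun x hx ↦ hF₀ (by simp only [F₀, Finset.mem_union]; tauto))
    (fun x hx ↦ hF₀ (by simp only [F₀, Finset.mem_union]; tauto)) hFg
  have key' : (W.card : ℕ∞) + V₀.card * L ≤ Fintype.card V * L := by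
    rw [hL]
    refine le_trans ?_ key
    gcongr
    exact le_mul_of_one_le_right' (Order.one_le_iff_ne_zero.2 hI)
  have key'' : (W.card : ℝ) + V₀.card * L ≤ Fintype.card V * L := by exact_mod_cast key'
  have hW' : (V₀.card : ℝ) ≤ W.card * D := by exact_mod_cast hWcard
  have hn : (0 : ℝ) < Fintype.card V := by exact_mod_cast Fintype.card_pos
  have hD : (0 : ℝ) ≤ D := by positivity
  have hDL : (0 : ℝ) ≤ D * L := by positivity
  have h1 : (V₀.card : ℝ) * (1 + D * L) ≤ D * L * Fintype.card V := by
    nlinarith [mul_le_mul_of_nonneg_left key'' hD]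
  have h2 := (mul_le_mul_of_nonneg_right hcard (by positivity : (0 : ℝ) ≤ 1 + D * L)).trans h1
  have h3 : (1 - (2 + D * L : ℝ)⁻¹) * (1 + D * L) ≤ D * L :=
    le_of_mul_le_mul_right (by linarith) hn
  have h4 : (1 - (2 + D * L : ℝ)⁻¹) * (1 + D * L) = D * L + (2 + D * L : ℝ)⁻¹ := by
    field_simp
    ring
  have h5 : (0 : ℝ) < (2 + D * L : ℝ)⁻¹ := by positivity
  linarith

namespace FactorsThrough

variable {T : ObjectProperty C} {X Y : C}

theorem of_prop_image {f : X ⟶ Y} (h : T (image f)) : FactorsThrough T f :=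
  ⟨_, h, factorThruImage f, image.ι f, image.fac f⟩

variable [T.IsSerreClass]

theorem sum {J : Type*} {s : Finset J} {f : J → (X ⟶ Y)} (h : ∀ j ∈ s, FactorsThrough T (f j)) :
    FactorsThrough T (∑ j ∈ s, f j) := by
  refine Finset.sum_induction f (FactorsThrough T) ?_ ?_ h
  · rintro _ _ ⟨A, hA, u, w, rfl⟩ ⟨A', hA', u', w', rfl⟩
    exact ⟨A ⊞ A', T.prop_biprod hA hA', biprod.lift u u', biprod.desc w w', by simp⟩
  · exact ⟨_, T.prop_of_isZero (isZero_zero C), 0, 0, by simp⟩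

theorem prop_image {f : X ⟶ Y} (h : FactorsThrough T f) : T (image f) := by
  obtain ⟨A, hA, u, w, rfl⟩ := h
  exact T.prop_of_mono (image.preComp u w) (T.prop_of_epi (factorThruImage w) hA)

end FactorsThrough

/-- The restriction of endomorphisms to a subobject that is stable under all of them. -/
noncomputable def endRestrict {M M' : C} (i : M' ⟶ M) [Mono i]
    (h : ∀ f : M ⟶ M, ∃ f' : M' ⟶ M', f' ≫ i = i ≫ f) : End M →+* End M' where
  toFun f := (h f).choose
  map_one' := by
    rw [← cancel_mono i, (h _).choose_spec]
    exact (Category.comp_id i).trans (Category.id_comp i).symm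
  map_mul' f g := by
    rw [← cancel_mono i, (h _).choose_spec, End.mul_def, End.mul_def, Category.assoc,
      (h f).choose_spec, ← Category.assoc, ← Category.assoc, (h g).choose_spec]
  map_zero' := by
    rw [← cancel_mono i, (h _).choose_spec]
    exact comp_zero.trans zero_comp.symm
  map_add' f g := by
    rw [← cancel_mono i, (h _).choose_spec]
    erw [Preadditive.comp_add, Preadditive.add_comp]
    rw [(h f).choose_spec, (h g).choose_spec]

theorem endRestrict_comp {M M' : C} (i : M' ⟶ M) [Mono i]
    (h : ∀ f : M ⟶ M, ∃ f' : M' ⟶ M', f' ≫ i = i ≫ f) (f : End M) :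
    (endRestrict i h f : M' ⟶ M') ≫ i = i ≫ f :=
  (h f).choose_spec

/-- The group ring of a sofic group over the endomorphism ring of a Noetherian object is directly
finite. -/
theorem isDedekindFiniteMonoid_monoidAlgebra_end {G : Type*} [Group G] (hG : IsSofic G) (M : C)
    [IsNoetherianObject M] : IsDedekindFiniteMonoid (MonoidAlgebra (End M) G) where
  mul_eq_one_symm {α β} hαβ := by
    classical
    by_contra hβα
    set e := 1 - β * α with he
    have he0 : e ≠ 0 := fun h ↦ hβα (sub_eq_zero.1 h).symm
    have hee : e * e = e := by
      have : β * α * (β * α) = β * α := by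
        rw [mul_assoc, ← mul_assoc α, hαβ, one_mul]
      rw [he, sub_mul, one_mul, mul_sub, mul_one, this, sub_self, sub_zero]
    -- The image of `d` is the sum of the images of all coefficients of `e`.
    let d : (⨁ fun _ : e.coeff.support ↦ M) ⟶ M := biproduct.desc fun g ↦ (e.coeff g.1 : M ⟶ M)
    have hd (g : G) : ∃ r : M ⟶ image d, r ≫ image.ι d = e.coeff g := by
      by_cases hg : g ∈ e.coeff.support
      · exact ⟨biproduct.ι (fun _ : e.coeff.support ↦ M) ⟨g, hg⟩ ≫ factorThruImage d, by simp [d]⟩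
      · exact ⟨0, by exact zero_comp.trans (Finsupp.notMem_support_iff.1 hg).symm⟩
    have hE0 : ¬ IsZero (image d) := by
      intro h0
      refine he0 (MonoidAlgebra.ext (Finsupp.ext fun g ↦ ?_))
      obtain ⟨r, hr⟩ := hd g
      rw [← hr, h0.eq_of_tgt r 0, zero_comp]
      rfl
    have : IsNoetherianObject (image d) := isNoetherianObject_of_mono (image.ι d)
    obtain ⟨T, _, hTE, hlen⟩ := exists_serreClass_lengthMod_ne_top (image d) hE0
    have := isSerreClass_lengthMod_ne_top (T := T)
    -- All the coefficients of `e` take their values in the largest subobject of finite length.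
    obtain ⟨M', i, _, hM', hi⟩ := exists_largest_subobject (fun X ↦ lengthMod T X ≠ ⊤) M
    have hstable (f : M ⟶ M) : ∃ f' : M' ⟶ M', f' ≫ i = i ≫ f := hi M' (i ≫ f) hM'
    let ρ := endRestrict i hstable
    let ρG := MonoidAlgebra.mapRingHom G ρ
    have hρe (g : G) : T (image (ρ (e.coeff g) : M' ⟶ M')) := by
      have h := length_image_coeff_eq_zero hG (isAdditive_lengthMod T) hM'
        (α := ρG α) (β := ρG β) (by rw [← map_mul, hαβ, map_one]) g
      rw [← map_mul, ← map_one ρG, ← map_sub, lengthMod_eq_zero_iff] at h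
      rwa [MonoidAlgebra.coeff_mapRingHom] at h
    have hmul (g h : G) : FactorsThrough T (e.coeff g * e.coeff h : End M) := by
      obtain ⟨r, hr⟩ := hd h
      obtain ⟨y, hy⟩ := hi _ (image.ι d) hlen
      have : (e.coeff g * e.coeff h : End M) = r ≫ y ≫ (ρ (e.coeff g) : M' ⟶ M') ≫ i := by
        rw [endRestrict_comp, reassoc_of% hy, reassoc_of% hr]
        rfl
      rw [this]
      exact ((((FactorsThrough.of_prop_image (hρe g)).comp_right i).comp_left y).comp_left r)
    have hcoeff (k : G) : FactorsThrough T (e.coeff k : M ⟶ M) := by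
      rw [← hee, MonoidAlgebra.coeff_mul]
      refine FactorsThrough.sum fun g _ ↦ FactorsThrough.sum fun h _ ↦ ?_
      dsimp only
      split_ifs
      · exact hmul g h
      · exact FactorsThrough.sum (s := (∅ : Finset G)) (f := fun _ ↦ 0) (by simp)
    refine hTE (FactorsThrough.prop_image ?_)
    have hsum : d = ∑ g, biproduct.π _ g ≫ (e.coeff g.1 : M ⟶ M) :=
      biproduct.hom_ext' _ _ fun g ↦ by
        rw [biproduct.ι_desc, Preadditive.comp_sum, Finset.sum_eq_single g]
        · simp
        · intro h _ hgh
          rw [biproduct.ι_π_ne_assoc _ hgh.symm, zero_comp]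
        · simp
    rw [hsum]
    exact FactorsThrough.sum fun g _ ↦ (hcoeff g.1).comp_left _

end GroupRing

end CategoryTheory

/-! ### Morphisms from a Noetherian object to a coproduct -/

namespace CategoryTheory

section Coproduct

variable {C : Type u} [Category.{v} C] [Abelian C] [IsGrothendieckAbelian.{v} C]

attribute [local instance] IsFiltered.isConnected

open IsGrothendieckAbelian.IsPresentable in
/-- By exactness of filtered colimits, a Noetherian object `M` is the union of the inverse images of
the terms of a filtered diagram of subobjects; by the ascending chain condition, it is one
of them. -/
theorem exists_eq_comp_of_isNoetherianObject {J : Type v} [SmallCategory J] [IsFiltered J]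
    {Y : J ⥤ C} {c : Cocone Y} (hc : IsColimit c) [∀ j, Mono (c.ι.app j)] {M : C}
    [IsNoetherianObject M] (z : M ⟶ c.pt) : ∃ (j : J) (y : M ⟶ Y.obj j), z = y ≫ c.ι.app j := by
  have : Mono c.ι := NatTrans.mono_of_mono_app c.ι
  let F := surjectivity.F z (c := c)
  have hepi : Epi (surjectivity.f z) := surjectivity.epi_f hc z
  have hmono : Mono (surjectivity.f z) := IsGrothendieckAbelian.mono_of_isColimit_monoOver F (colimit.isColimit _)
    (surjectivity.f z) (surjectivity.hf z)
  have hsup : Subobject.mk (surjectivity.f z) = _ := IsGrothendieckAbelian.subobjectMk_of_isColimit_eq_iSup F (colimit.isColimit _)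
    (surjectivity.f z) (surjectivity.hf z)
  rw [(Subobject.epi_iff_mk_eq_top _).1 hepi] at hsup
  let s (j : J) : Subobject M := Subobject.mk (F.obj j).obj.hom
  have hs {j j' : J} (f : j ⟶ j') : s j ≤ s j' := MonoOver.subobjectMk_le_mk_of_hom (F.map f)
  obtain ⟨_, ⟨j, rfl⟩, hj⟩ := (wellFounded_gt (α := Subobject M)).has_min (Set.range s)
    ⟨_, IsFiltered.nonempty.some, rfl⟩
  have hle (j' : J) : s j' ≤ s j := by
    have h := hs (IsFiltered.leftToMax j j')
    have h' : s (IsFiltered.max j j') ≤ s j := by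
      by_contra hn
      exact hj _ ⟨_, rfl⟩ (lt_of_le_not_ge h hn)
    exact (hs (IsFiltered.rightToMax j j')).trans h'
  have htop : s j = ⊤ := top_le_iff.1 (hsup.le.trans (iSup_le hle))
  let p : (pullback c.ι ((Functor.const J).map z)).obj j ⟶ M :=
    (pullback.snd c.ι ((Functor.const J).map z)).app j
  let q : (pullback c.ι ((Functor.const J).map z)).obj j ⟶ Y.obj j :=
    (pullback.fst c.ι ((Functor.const J).map z)).app j
  have hpq : q ≫ c.ι.app j = p ≫ z :=
    NatTrans.congr_app (pullback.condition (f := c.ι) (g := (Functor.const J).map z)) j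
  have : Mono p := inferInstanceAs (Mono (F.obj j).obj.hom)
  have : IsIso p := (Subobject.isIso_iff_mk_eq_top _).2 htop
  exact ⟨j, inv p ≫ q, by rw [Category.assoc, hpq, IsIso.inv_hom_id_assoc]⟩

open CoproductsFromFiniteFiltered in
/-- A morphism from a Noetherian object to a coproduct is a finite sum of morphisms to the terms. -/
theorem exists_eq_sum_comp_ι {G : Type v} {X : G → C} {M : C} [IsNoetherianObject M]
    (z : M ⟶ ∐ X) :
    ∃ (s : Finset G) (a : ∀ g, M ⟶ X g), z = ∑ g ∈ s, a g ≫ Sigma.ι X g := by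
  classical
  let inc (S : Finset (Discrete G)) : (∐ fun x : S ↦ X x.1.as) ⟶ ∐ X :=
    Limits.Sigma.desc fun x ↦ Sigma.ι X x.1.as
  have hmono (S : Finset (Discrete G)) : Mono (inc S) := by
    let r : ∐ X ⟶ ∐ fun x : S ↦ X x.1.as := Limits.Sigma.desc fun g ↦
      if h : Discrete.mk g ∈ S then Sigma.ι (fun x : S ↦ X x.1.as) ⟨⟨g⟩, h⟩ else 0
    have : inc S ≫ r = 𝟙 _ := by
      refine Sigma.hom_ext _ _ fun x ↦ ?_
      simp [inc, r]
    exact mono_of_mono_fac this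
  have (S : Finset (Discrete G)) : Mono ((finiteSubcoproductsCocone X).ι.app S) := hmono S
  obtain ⟨S, y, hy⟩ := exists_eq_comp_of_isNoetherianObject (isColimitFiniteSubproductsCocone X) z
  have hy' : ∃ y' : M ⟶ ∐ fun x : S ↦ X x.1.as, z = y' ≫ inc S := ⟨y, hy⟩
  obtain ⟨y', rfl⟩ := hy'
  refine ⟨S.image Discrete.as, fun g ↦ y' ≫ inc S ≫ Sigma.π X g, ?_⟩
  have : inc S = ∑ g ∈ S.image Discrete.as, (inc S ≫ Sigma.π X g) ≫ Sigma.ι X g := by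
    refine Sigma.hom_ext _ _ fun x ↦ ?_
    rw [Preadditive.comp_sum, Finset.sum_eq_single x.1.as]
    · simp [inc]
    · intro g _ hg
      simp [inc, Sigma.ι_π_of_ne_assoc _ hg.symm]
    · intro h
      exact absurd (Finset.mem_image_of_mem _ x.2) h
  conv_lhs => rw [this, Preadditive.comp_sum]
  simp

end Coproduct

end CategoryTheory

/-! ### Endomorphisms of an induced representation -/

namespace GroupRep

section Induced

variable {C : Type u} [Category.{v} C] [HasColimitsOfSize.{v, v} C] {G : Type v} [Group G] {M : C}

/-- Morphisms from an induced representation are determined by the copy with index `1`. -/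
theorem induced_hom_ext {Y : Rep G C} {φ ψ : (induced G C).obj M ⟶ Y}
    (h : ι M 1 ≫ φ.app (SingleObj.star G) = ι M 1 ≫ ψ.app (SingleObj.star G)) : φ = ψ := by
  ext x
  refine Sigma.hom_ext _ _ fun g ↦ ?_
  change ι M g ≫ φ.app (SingleObj.star G) = ι M g ≫ ψ.app (SingleObj.star G)
  have hg : ι M g = ι M 1 ≫ ((induced G C).obj M).map (X := SingleObj.star G)
      (Y := SingleObj.star G) g := by rw [ι_comp_induced_map, mul_one]
  rw [hg, Category.assoc, Category.assoc, φ.naturality, ψ.naturality, reassoc_of% h]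

/-- The morphism from an induced representation that is given by `f` on the copy with
index `1`. -/
noncomputable def inducedDesc {Y : Rep G C} (f : M ⟶ Y.obj (SingleObj.star G)) :
    (induced G C).obj M ⟶ Y where
  app _ := Sigma.desc fun g ↦ f ≫ Y.map (X := SingleObj.star G) (Y := SingleObj.star G) g
  naturality x y k := by
    refine Sigma.hom_ext _ _ fun g ↦ ?_
    let d : ((induced G C).obj M).obj (SingleObj.star G) ⟶ Y.obj (SingleObj.star G) :=
      Sigma.desc fun g ↦ f ≫ Y.map (X := SingleObj.star G) (Y := SingleObj.star G) g
    have hd (g : G) : ι M g ≫ d = f ≫ Y.map (X := SingleObj.star G) (Y := SingleObj.star G) g :=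
      Sigma.ι_desc _ _
    have key (k g : G) :
        ι M g ≫ ((induced G C).obj M).map (X := SingleObj.star G) (Y := SingleObj.star G) k ≫ d =
          ι M g ≫ d ≫ Y.map (X := SingleObj.star G) (Y := SingleObj.star G) k := by
      rw [← Category.assoc, ι_comp_induced_map, hd, ← Category.assoc, hd, Category.assoc,
        ← Y.map_comp]
      rfl
    exact key k g

theorem ι_inducedDesc {Y : Rep G C} (f : M ⟶ Y.obj (SingleObj.star G)) (g : G) :
    ι M g ≫ (inducedDesc f).app (SingleObj.star G) =
      f ≫ Y.map (X := SingleObj.star G) (Y := SingleObj.star G) g :=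
  Sigma.ι_desc _ _

/-- The endomorphism of the induced representation of `M` that maps the copy with index `g` to the
copy with index `g * h` by means of the endomorphism `a` of `M`. -/
noncomputable def translate (a : M ⟶ M) (h : G) : (induced G C).obj M ⟶ (induced G C).obj M :=
  inducedDesc (a ≫ ι M h)

theorem ι_translate (a : M ⟶ M) (g h : G) :
    ι M g ≫ (translate a h).app (SingleObj.star G) = a ≫ ι M (g * h) := by
  rw [translate, ι_inducedDesc, Category.assoc, ι_comp_induced_map]

theorem translate_comp (a b : M ⟶ M) (h k : G) :
    translate a h ≫ translate b k = translate (a ≫ b) (h * k) := by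
  refine induced_hom_ext ?_
  rw [NatTrans.comp_app, ← Category.assoc, ι_translate, ι_translate, Category.assoc, ι_translate,
    Category.assoc, mul_assoc]

theorem translate_id_one : translate (𝟙 M) (1 : G) = 𝟙 ((induced G C).obj M) := by
  refine induced_hom_ext ?_
  rw [ι_translate, NatTrans.id_app, Category.id_comp, Category.comp_id, mul_one]

end Induced

section GroupRing

variable {C : Type u} [Category.{v} C] [Abelian C] [HasColimitsOfSize.{v, v} C]
variable {G : Type v} [Group G]

theorem translate_add {M : C} (a b : M ⟶ M) (h : G) :
    translate (a + b) h = translate a h + translate b h := by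
  refine induced_hom_ext ?_
  rw [ι_translate, NatTrans.app_add, Preadditive.comp_add, ι_translate, ι_translate,
    Preadditive.add_comp]

/-- The canonical homomorphism from the group ring of `G` over `End M` to the endomorphism ring of
the induced representation. Since `G` acts on the induced representation by left translations,
an element of `G` acts by a right translation, and it must be inverted in order to get a
homomorphism. -/
noncomputable def monoidAlgebraToEnd (M : C) :
    MonoidAlgebra (End M) G →+* End ((induced G C).obj M) :=
  MonoidAlgebra.liftNCRingHom
    (RingHom.mk'
      { toFun (a : End M) := translate (G := G) (M := M) a 1
        map_one' := translate_id_one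
        map_mul' (a b : End M) := ((translate_comp (M := M) b a 1 1).trans (by simp)).symm }
      fun a b ↦ translate_add (M := M) a b 1)
    { toFun g := translate (𝟙 M) g⁻¹
      map_one' := by
        rw [inv_one]
        exact translate_id_one
      map_mul' g h := ((translate_comp (𝟙 M) (𝟙 M) h⁻¹ g⁻¹).trans (by simp)).symm }
    fun (a : End M) g ↦ (translate_comp (M := M) (𝟙 M) a g⁻¹ 1).trans <| by
      rw [Category.id_comp, mul_one, ← one_mul g⁻¹]
      exact congrArg (translate · _) (Category.comp_id (X := M) a).symm |>.trans
        (translate_comp (M := M) a (𝟙 M) 1 g⁻¹).symm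

theorem monoidAlgebraToEnd_single (M : C) (g : G) (a : End M) :
    monoidAlgebraToEnd M (MonoidAlgebra.single g a) = translate (M := M) a g⁻¹ := by
  refine (MonoidAlgebra.liftNCRingHom_single _ _ _ _ _).trans ?_
  refine (translate_comp (M := M) (𝟙 M) a g⁻¹ 1).trans ?_
  rw [Category.id_comp, mul_one]

open Classical in
/-- The projection of the induced representation to the copy of `M` with index `g`. -/
noncomputable def proj (M : C) (g : G) :
    ((induced G C).obj M).obj (SingleObj.star G) ⟶ M :=
  Sigma.π (fun _ : G ↦ M) g

open Classical in
theorem ι_proj_self (M : C) (g : G) : ι M g ≫ proj M g = 𝟙 M :=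
  Sigma.ι_π_eq_id _ _

open Classical in
theorem ι_proj_ne (M : C) {g h : G} (hgh : g ≠ h) : ι M g ≫ proj M h = 0 :=
  Sigma.ι_π_of_ne _ hgh

theorem ι_monoidAlgebraToEnd_proj (M : C) (x : MonoidAlgebra (End M) G) (g : G) :
    ι M 1 ≫ (monoidAlgebraToEnd M x : (induced G C).obj M ⟶ _).app (SingleObj.star G) ≫
      proj M g⁻¹ = x.coeff g := by
  classical
  induction x using MonoidAlgebra.induction_linear with
  | zero =>
    rw [map_zero]
    exact (congrArg (ι M 1 ≫ ·) zero_comp).trans comp_zero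
  | add x y hx hy =>
    rw [map_add, MonoidAlgebra.coeff_add, Finsupp.add_apply]
    refine Eq.trans ?_ (congrArg₂ (fun a b : M ⟶ M ↦ a + b) hx hy)
    rw [← Preadditive.comp_add, ← Preadditive.add_comp]
    rfl
  | single h a =>
    rw [monoidAlgebraToEnd_single, ← Category.assoc, ι_translate, one_mul,
      MonoidAlgebra.coeff_single, Finsupp.single_apply, Category.assoc]
    split_ifs with hgh
    · rw [hgh, ι_proj_self, Category.comp_id]
    · exact (congrArg (a ≫ ·) (ι_proj_ne M (inv_injective.ne hgh))).trans comp_zero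

theorem monoidAlgebraToEnd_injective (M : C) :
    Function.Injective (monoidAlgebraToEnd (G := G) M) := by
  intro x y hxy
  refine MonoidAlgebra.ext (Finsupp.ext fun g ↦ ?_)
  rw [← ι_monoidAlgebraToEnd_proj, ← ι_monoidAlgebraToEnd_proj, hxy]

end GroupRing

theorem monoidAlgebraToEnd_surjective {C : Type u} [Category.{v} C] [Abelian C]
    [IsGrothendieckAbelian.{v} C] {G : Type v} [Group G] (M : C) [IsNoetherianObject M] :
    Function.Surjective (monoidAlgebraToEnd (G := G) M) := by
  intro φ
  obtain ⟨s, a, ha⟩ := exists_eq_sum_comp_ι (X := fun _ : G ↦ M)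
    (ι M 1 ≫ (φ : (induced G C).obj M ⟶ _).app (SingleObj.star G))
  have ha' : ι M 1 ≫ (φ : (induced G C).obj M ⟶ _).app (SingleObj.star G) =
    ∑ g ∈ s, a g ≫ ι M g := ha
  refine ⟨∑ g ∈ s, MonoidAlgebra.single g⁻¹ (a g : End M), ?_⟩
  rw [map_sum]
  have h : (∑ g ∈ s, translate (a g) g) = (φ : (induced G C).obj M ⟶ _) := by
    refine induced_hom_ext ?_
    rw [ha', NatTrans.app_sum, Preadditive.comp_sum]
    simp_rw [ι_translate, one_mul]
  refine Eq.trans (Finset.sum_congr rfl fun g _ ↦ ?_) h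
  rw [monoidAlgebraToEnd_single, inv_inv]

theorem isDedekindFiniteMonoid_end_induced {C : Type u} [Category.{v} C] [Abelian C]
    [IsGrothendieckAbelian.{v} C] {G : Type v} [Group G] (hG : IsSofic G) (M : C)
    [IsNoetherianObject M] : IsDedekindFiniteMonoid (End ((induced G C).obj M)) := by
  have := isDedekindFiniteMonoid_monoidAlgebra_end hG M
  let e := RingEquiv.ofBijective (monoidAlgebraToEnd (G := G) M)
    ⟨monoidAlgebraToEnd_injective M, monoidAlgebraToEnd_surjective M⟩
  exact .of_injective e.symm.toMonoidHom e.symm.injective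

end GroupRep

/-! ### Matrices over endomorphism rings -/

namespace CategoryTheory

/-- If the endomorphism ring of the sum of `n` copies of `X` is directly finite, so is the ring of
`n × n` matrices over the endomorphism ring of `X`. -/
theorem isDedekindFiniteMonoid_matrix_end {D : Type*} [Category* D] [Preadditive D]
    [HasFiniteBiproducts D] (X : D) (n : ℕ)
    [IsDedekindFiniteMonoid (End (⨁ fun _ : Fin n ↦ X))] :
    IsDedekindFiniteMonoid (Matrix (Fin n) (Fin n) (End X)) := by
  let f : Matrix (Fin n) (Fin n) (End X) →* End (⨁ fun _ : Fin n ↦ X) :=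
    { toFun A := biproduct.matrix fun j i ↦ (A i j : X ⟶ X)
      map_one' := by
        refine biproduct.hom_ext _ _ fun i ↦ biproduct.hom_ext' _ _ fun j ↦ ?_
        rw [biproduct.matrix_π, biproduct.ι_desc, End.one_def, Category.id_comp]
        by_cases h : i = j
        · subst h
          rw [biproduct.ι_π_self, Matrix.one_apply_eq]
          rfl
        · rw [biproduct.ι_π_ne _ (Ne.symm h), Matrix.one_apply_ne h]
      map_mul' A B := by
        refine biproduct.hom_ext _ _ fun i ↦ biproduct.hom_ext' _ _ fun j ↦ ?_
        rw [End.mul_def, Category.assoc, biproduct.matrix_π, biproduct.matrix_π,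
          biproduct.ι_matrix_assoc, biproduct.lift_desc, biproduct.ι_desc, Matrix.mul_apply]
        rfl }
  refine .of_injective f fun A B h ↦ ?_
  ext i j
  have h' := congrArg (fun φ : (⨁ fun _ : Fin n ↦ X) ⟶ ⨁ fun _ : Fin n ↦ X ↦
    biproduct.ι (fun _ ↦ X) j ≫ φ ≫ biproduct.π (fun _ ↦ X) i) h
  simpa [f] using h'

theorem isDedekindFiniteMonoid_end_of_iso {D : Type*} [Category* D] {X Y : D} (e : X ≅ Y)
    [IsDedekindFiniteMonoid (End X)] : IsDedekindFiniteMonoid (End Y) :=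
  .of_injective e.symm.conj.toMonoidHom e.symm.conj.injective

end CategoryTheory

theorem mainTheorem2 {C : Type u} [Category.{v} C] [Abelian C] [IsGrothendieckAbelian.{v} C]
    {G : Type v} [Group G] (hG : IsSofic G) (N : C) [IsNoetherianObject N] :
    IsStablyFiniteRing (End ((GroupRep.induced G C).obj N)) := by
  have := Abelian.hasFiniteBiproducts (C := C)
  have := Abelian.hasFiniteBiproducts (C := GroupRep.Rep G C)
  refine ⟨fun n ↦ ?_⟩
  have := isNoetherianObject_biproduct_const N n
  have := GroupRep.isDedekindFiniteMonoid_end_induced hG (⨁ fun _ : Fin n ↦ N)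
  have : PreservesColimitsOfSize.{0, 0} (GroupRep.induced G C) :=
    (GroupRep.inducedAdjunction G C).leftAdjoint_preservesColimits
  have := (GroupRep.inducedAdjunction G C).isLeftAdjoint
  have : (GroupRep.induced G C).PreservesZeroMorphisms :=
    Functor.preservesZeroMorphisms_of_isLeftAdjoint _
  have : PreservesBiproduct (fun _ : Fin n ↦ N) (GroupRep.induced G C) :=
    preservesBiproduct_of_preservesCoproduct _
  have : IsDedekindFiniteMonoid (End (⨁ fun _ : Fin n ↦ (GroupRep.induced G C).obj N)) :=
    isDedekindFiniteMonoid_end_of_iso ((GroupRep.induced G C).mapBiproduct fun _ : Fin n ↦ N)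
  exact isDedekindFiniteMonoid_matrix_end ((GroupRep.induced G C).obj N) n
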